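/- Let $F/M$ be a finite separable extension of complete discrete valuation fields (the residue field extension may be inseparable), with rings of integers $\mathcal{O}_F/\mathcal{O}_M$. Let \[\mathcal{O}_F\cong\mathcal{O}_M[T_1,\dots,T_m]_{\mathfrak{n}}/\langle f_1,\dots,f_m\rangle\] be any presentation of $\mathcal{O}_F$ as a complete intersection over $\mathcal{O}_M$, where $\mathfrak{n}$ is a maximal ideal of $\mathcal{O}_M[T_1,\dots,T_m]$ lying over the maximal ideal of $\mathcal{O}_M$ and $f_1,\dots,f_m\in\mathfrak{n}$ are polynomials forming a regular sequence in $\mathcal{O}_M[T_1,\dots,T_m]_{\mathfrak{n}}$. Let $J\in\mathcal{O}_F$ be the image of the Jacobian determinant $\det(\partial f_i/\partial T_j)_{1\le i,j\le m}$, and let \[\mathfrak{C}(\mathcal{O}_F/\mathcal{O}_M)=\{x\in F:\operatorname{Tr}_{F/M}(x\mathcal{O}_F)\subseteq\mathcal{O}_M\}\] be the codifferent. Then $J\neq0$ and \[\mathfrak{C}(\mathcal{O}_F/\mathcal{O}_M)=J^{-1}\mathcal{O}_F.\] Equivalently, the different $\mathfrak{D}(\mathcal{O}_F/\mathcal{O}_M)=\{x\in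 F:x\,\mathfrak{C}(\mathcal{O}_F/\mathcal{O}_M)\subseteq\mathcal{O}_F\}$, the inverse fractional ideal of the codifferent, is equal to the Jacobian ideal $J\mathcal{O}_F$. -/

import Mathlib

noncomputable section

/-- A presentation of the algebra `S` over the local ring `R` as a complete intersection
`S = R[T₁, …, Tₘ]_𝔫 / ⟨f₁, …, fₘ⟩` with as many relations as variables: `𝔫` is a maximal ideal of
`R[T₁, …, Tₘ]` over the maximal ideal of `R`, and `f₁, …, fₘ ∈ 𝔫` are polynomials which form a
regular sequence in the local ring `R[T₁, …, Tₘ]_𝔫`. (By flatness of localization, a sequence of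
elements of `𝔫` that is regular in `R[T₁, …, Tₘ]` has this property.) -/
structure LocalCompleteIntersection (R S : Type*) [CommRing R] [IsLocalRing R] [CommRing S]
    [Algebra R S] (m : ℕ) where
  /-- the maximal ideal `𝔫` -/
  ideal : Ideal (MvPolynomial (Fin m) R)
  [isMaximal : ideal.IsMaximal]
  [liesOver : ideal.LiesOver (IsLocalRing.maximalIdeal R)]
  /-- the polynomials `f₁, …, fₘ` -/
  relation : Fin m → MvPolynomial (Fin m) R
  relation_mem : ∀ i, relation i ∈ ideal
  isRegular : RingTheory.Sequence.IsRegular (Localization.AtPrime ideal)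
    (List.ofFn fun i => algebraMap (MvPolynomial (Fin m) R) (Localization.AtPrime ideal)
      (relation i))
  /-- the isomorphism of `R`-algebras `R[T₁, …, Tₘ]_𝔫 / ⟨f₁, …, fₘ⟩ ≃ S` -/
  equiv : (Localization.AtPrime ideal ⧸ Ideal.span (Set.range fun i =>
    algebraMap (MvPolynomial (Fin m) R) (Localization.AtPrime ideal) (relation i))) ≃ₐ[R] S

namespace LocalCompleteIntersection

variable {R S : Type*} [CommRing R] [IsLocalRing R] [CommRing S] [Algebra R S] {m : ℕ}

attribute [instance] isMaximal liesOver

/-- The image in `S` of a polynomial, under `R[T₁, …, Tₘ] → R[T₁, …, Tₘ]_𝔫 / ⟨f₁, …, fₘ⟩ ≃ S`. -/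
def image (P : LocalCompleteIntersection R S m) (g : MvPolynomial (Fin m) R) : S :=
  P.equiv (Ideal.Quotient.mk _
    (algebraMap (MvPolynomial (Fin m) R) (Localization.AtPrime P.ideal) g))

/-- The determinant in `S` of the Jacobian matrix `(∂fᵢ/∂Tⱼ)`. -/
def jacobian (P : LocalCompleteIntersection R S m) : S :=
  Matrix.det (Matrix.of fun i j : Fin m => P.image (MvPolynomial.pderiv j (P.relation i)))

end LocalCompleteIntersection

section Codifferent

variable (A M B F : Type*) [CommRing A] [Field M] [CommRing B] [Field F]
  [Algebra A M] [Algebra B F] [Algebra A B] [Algebra M F] [Algebra A F]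
  [IsScalarTower A M F] [IsScalarTower A B F]

/-- The codifferent `{x ∈ F : Tr_{F/M}(xB) ⊆ A}` of `B/A`, as a `B`-submodule of `F`. -/
def codifferent : Submodule B F := Submodule.traceDual A M (1 : Submodule B F)

/-- Unfolding of the definition of the codifferent. -/
theorem mem_codifferent {x : F} : x ∈ codifferent A M B F ↔
    ∀ b : B, Algebra.trace M F (x * algebraMap B F b) ∈ (algebraMap A M).range := by
  simp [codifferent, Submodule.mem_traceDual, Submodule.mem_one, Algebra.traceForm_apply]

/-- The different of `B/A`: the complementary fractional ideal
`{x ∈ F : x · codifferent ⊆ B}` of the codifferent, as a `B`-submodule of `F`. -/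
def different : Submodule B F := 1 / codifferent A M B F

end Codifferent

end

/-! `B` turns out to be finite free over `A`, and an argument of Tate exhibits a generator `lam` of
the `B`-module `Hom(B, A)` with `Tr = lam(J ·)`. Hence `Tr(x ·)` is `A`-valued on `B` exactly when
it equals some `lam(c ·) = Tr(J⁻¹c ·)` with `c ∈ B`, that is, when `x ∈ J⁻¹B`; separability gives `J
≠ 0` (`codifferent_eq_span_inv`).

To find `lam`, let `t` be the image of `T`, expand `fᵢ(X + t) = ∑ cᵢⱼ Xⱼ` over `B` and substitute
`Xⱼ = 1 ⊗ tⱼ - tⱼ ⊗ 1`. By Cramer's rule the determinant `Δ ∈ B ⊗ B` of the resulting matrix kills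
every `1 ⊗ b - b ⊗ 1`, and multiplication sends it to `J`. Such a `Δ` yields `lam` once some `id ⊗
φ` takes it to a unit (`exists_generator_dual_of_tmul_comm`), for which it suffices that `Δ ≠ 0` in
`κ ⊗ B`, with `κ` the residue field of `B`. This is the crux: over a field, `det C` is not in `⟨C
X⟩` locally at the origin if that ideal contains powers of all variables there
(`MvPolynomial.mul_det_notMem_span`).

Finiteness of `B` comes from Zariski's lemma for the residue fields and completeness of `A`
(`Module.Finite.of_finite_residueField`). -/

open IsLocalRing TensorProduct

/-! ### Determinants of matrices agreeing on a vector -/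

open Matrix in
/-- If `D` and `D'` agree on the vector `g`, then their determinants agree modulo every ideal
containing the quotients of `⟨(D g)ₖ : k ≠ i⟩` by `gᵢ`. -/
theorem Matrix.det_sub_det_mem_of_mulVec_eq {n R : Type*} [Fintype n] [DecidableEq n] [CommRing R]
    {D D' : Matrix n n R} {g v : n → R} (hD : D *ᵥ g = v) (hD' : D' *ᵥ g = v) {I : Ideal R}
    (hI : ∀ i δ, δ * g i ∈ Ideal.span (v '' {k | k ≠ i}) → δ ∈ I) : D'.det - D.det ∈ I := by
  -- Replace the rows of `D` by those of `D'` one at a time.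
  let H (s : Finset n) : Matrix n n R := Matrix.of fun i => if i ∈ s then D' i else D i
  have key (s : Finset n) : (H s).det - D.det ∈ I := by
    induction s using Finset.induction_on with
    | empty =>
      have : H ∅ = D := by ext i j; simp [H]
      simp [this]
    | insert i s his ih =>
      have h1 : H (insert i s) = (H s).updateRow i (D' i) := by
        ext k l
        by_cases hk : k = i
        · subst hk; simp [H]
        · simp [H, hk]
      have h2 : H s = (H s).updateRow i (D i) := by
        ext k l
        by_cases hk : k = i
        · subst hk; simp [H, his]
        · simp [hk]
      have h3 : (H (insert i s)).det - (H s).det = ((H s).updateRow i (D' i - D i)).det := by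
        have := Matrix.det_updateRow_add (H s) i (D' i - D i) (D i)
        rw [sub_add_cancel, ← h1, ← h2] at this
        rw [this, add_sub_cancel_right]
      have h4 : (H (insert i s)).det - (H s).det ∈ I := by
        rw [h3]
        apply hI i
        set E := (H s).updateRow i (D' i - D i) with hE
        -- Cramer's rule: `det E * gᵢ` is a combination of the entries of `E g`, whose `i`-th entry
        -- vanishes.
        have h5 : E.adjugate *ᵥ (E *ᵥ g) = E.det • g := by
          rw [mulVec_mulVec, adjugate_mul, smul_mulVec, one_mulVec]
        have h6 := congrFun h5 i
        simp only [Pi.smul_apply, smul_eq_mul] at h6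
        rw [← h6]
        refine Ideal.sum_mem _ fun k _ => Ideal.mul_mem_left _ _ ?_
        by_cases hk : k = i
        · subst hk
          have : (E *ᵥ g) k = 0 := by
            have e1 := congrFun hD k
            have e2 := congrFun hD' k
            simp only [mulVec] at e1 e2 ⊢
            rw [hE, updateRow_self, sub_dotProduct, e1, e2, sub_self]
          rw [this]; exact zero_mem _
        · have : (E *ᵥ g) k = v k := by
            have e1 := congrFun hD k
            have e2 := congrFun hD' k
            simp only [mulVec] at e1 e2 ⊢
            rw [hE, updateRow_ne hk]
            by_cases hs : k ∈ s
            · rw [← e2]; simp [H, hs]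
            · rw [← e1]; simp [H, hs]
          rw [this]
          exact Ideal.subset_span ⟨k, hk, rfl⟩
      have := I.add_mem h4 ih
      rwa [sub_add_sub_cancel] at this
  have : H Finset.univ = D' := by ext i j; simp [H]
  rw [← this]; exact key _

/-! ### A determinant outside its ideal at the origin -/

namespace MvPolynomial

theorem mem_span_X_pow_iff {σ R : Type*} [CommRing R] (e : σ → ℕ) (s : Set σ)
    (p : MvPolynomial σ R) :
    p ∈ Ideal.span ((fun i => X i ^ e i) '' s) ↔ ∀ d ∈ p.support, ∃ k ∈ s, e k ≤ d k := by
  have : (fun i => (X i ^ e i : MvPolynomial σ R)) '' s =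
      (fun d => monomial d 1) '' ((fun i => Finsupp.single i (e i)) '' s) := by
    rw [Set.image_image]
    simp [X_pow_eq_monomial]
  rw [this, mem_ideal_span_monomial_image]
  simp

open Matrix in
/-- If the ideal `⟨f₁, …, fₘ⟩`, where `f = C X`, is primary to the origin, then `det C` does not
lie in its localization at the origin. -/
theorem mul_det_notMem_span {σ K : Type*} [Fintype σ] [DecidableEq σ] [Field K]
    (C : Matrix σ σ (MvPolynomial σ K)) {h : MvPolynomial σ K} (hh : constantCoeff h ≠ 0)
    (N : σ → ℕ) (hN : ∀ i, h * X i ^ (N i + 1) ∈ Ideal.span (Set.range (C *ᵥ X))) :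
    h * C.det ∉ Ideal.span (Set.range (C *ᵥ X)) := by
  intro hC
  have hex (i) : ∃ e : σ → MvPolynomial σ K, ∑ j, e j * (C *ᵥ X) j = h * X i ^ (N i + 1) :=
    Ideal.mem_span_range_iff_exists_fun.1 (hN i)
  choose e he using hex
  let E : Matrix σ σ (MvPolynomial σ K) := Matrix.of e
  have hE : E *ᵥ (C *ᵥ X) = fun i => h * X i ^ (N i + 1) := by
    ext1 i; exact he i
  let I : Ideal (MvPolynomial σ K) := Ideal.span ((fun i => X i ^ (N i + 1)) '' Set.univ)
  have hXI (i) : h * X i ^ (N i + 1) ∈ I :=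
    Ideal.mul_mem_left _ _ (Ideal.subset_span ⟨i, trivial, rfl⟩)
  -- `E C` and the diagonal matrix both send `X` to the vector `h Xᵢ ^ (Nᵢ + 1)`.
  have h1 : (diagonal fun i => h * X i ^ N i).det - (E * C).det ∈ I := by
    refine det_sub_det_mem_of_mulVec_eq (g := X) (v := fun i => h * X i ^ (N i + 1))
      (by rw [← mulVec_mulVec, hE]) (by ext1 i; rw [mulVec_diagonal]; ring) fun i δ hδ => ?_
    have hδ' : δ * X i ∈ Ideal.span ((fun k => X k ^ (N k + 1)) '' {k | k ≠ i}) := by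
      refine Ideal.span_le.2 ?_ hδ
      rintro _ ⟨k, hk, rfl⟩
      exact Ideal.mul_mem_left _ _ (Ideal.subset_span ⟨k, hk, rfl⟩)
    rw [mem_span_X_pow_iff (fun k => N k + 1)] at hδ' ⊢
    intro d hd
    obtain ⟨k, hk, hkd⟩ := hδ' (d + Finsupp.single i 1) (by
      rw [mem_support_iff] at hd ⊢
      rwa [coeff_mul_X])
    refine ⟨k, trivial, ?_⟩
    simpa [Finsupp.single_apply, Ne.symm hk] using hkd
  have h2 : ∀ x ∈ Ideal.span (Set.range (C *ᵥ X)), E.det * x ∈ I := by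
    intro x hx
    induction hx using Submodule.span_induction with
    | mem x hx =>
      obtain ⟨j, rfl⟩ := hx
      have : E.adjugate *ᵥ (E *ᵥ (C *ᵥ X)) = E.det • (C *ᵥ X) := by
        rw [mulVec_mulVec, adjugate_mul, smul_mulVec, one_mulVec]
      have := congrFun this j
      simp only [Pi.smul_apply, smul_eq_mul] at this
      rw [← this, hE]
      exact Ideal.sum_mem _ fun k _ => Ideal.mul_mem_left _ _ (hXI k)
    | zero => simp
    | add x y _ _ hx hy => rw [mul_add]; exact I.add_mem hx hy
    | smul a x _ hx => rw [smul_eq_mul, mul_left_comm]; exact I.mul_mem_left _ hx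
  -- If `h det C` were in the ideal, `h det E det C` would be in `I`. But the monomial `∏ Xᵢ ^ Nᵢ`,
  -- not in `I`, occurs here with a power of `h(0) ≠ 0` as coefficient.
  have h3 : h * (∏ i, h * X i ^ N i) ∈ I := by
    have := I.add_mem (I.mul_mem_left h h1) (h2 _ hC)
    rw [det_mul, det_diagonal] at this
    convert this using 1
    ring
  have h4 : h * (∏ i, h * X i ^ N i) =
      h ^ (Fintype.card σ + 1) * monomial (Finsupp.equivFunOnFinite.symm N) 1 := by
    rw [Finset.prod_mul_distrib, Finset.prod_const, Finset.card_univ, pow_succ',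
      monomial_eq, Finsupp.prod_fintype _ _ (by simp)]
    simp [mul_assoc]
  rw [h4, mem_span_X_pow_iff (fun k => N k + 1)] at h3
  obtain ⟨k, -, hk⟩ := h3 (Finsupp.equivFunOnFinite.symm N) (by
    rw [mem_support_iff]
    have := coeff_mul_monomial (0 : σ →₀ ℕ) (Finsupp.equivFunOnFinite.symm N) (1 : K)
      (h ^ (Fintype.card σ + 1))
    rw [zero_add] at this
    rw [this, mul_one, ← constantCoeff_eq, map_pow]
    exact pow_ne_zero _ hh)
  simp at hk

end MvPolynomial

/-! ### Duality from a symmetric tensor -/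

/-- Let `Δ ∈ B ⊗ B` satisfy `(1 ⊗ b) Δ = (b ⊗ 1) Δ` for all `b`, and suppose that the map
`Hom(B, A) → B` which it induces has a unit in its image. Then `Hom(B, A)` is free of rank one over
`B`, with a generator `lam` for which the trace of `B` is `μ(Δ) lam`, where `μ` is the
multiplication `B ⊗ B → B`. -/
theorem exists_generator_dual_of_tmul_comm {A B : Type*} [CommRing A] [CommRing B] [Algebra A B]
    [Module.Free A B] [Module.Finite A B] (Δ : B ⊗[A] B)
    (hΔ : ∀ b : B, (1 ⊗ₜ b) * Δ = (b ⊗ₜ 1) * Δ) (φ : B →ₗ[A] A)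
    (hφ : IsUnit (TensorProduct.rid A B (φ.lTensor B Δ))) :
    ∃ lam : B →ₗ[A] A, (∀ ψ : B →ₗ[A] A, ∃ c, ∀ x, ψ x = lam (c * x)) ∧
      (∀ c, (∀ x, lam (c * x) = 0) → c = 0) ∧
      ∀ y, Algebra.trace A B y = lam (Algebra.TensorProduct.lmul' A Δ * y) := by
  obtain ⟨u, hu⟩ := hφ
  obtain ⟨s, hs⟩ := TensorProduct.exists_finset Δ
  -- Apply `id ⊗ φ` to both sides of the symmetry relation.
  have h1 (b : B) : ∑ i ∈ s, φ (b * i.2) • i.1 = u * b := by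
    have := congrArg (fun z => TensorProduct.rid A B (φ.lTensor B z)) (hΔ b)
    have e2 : TensorProduct.rid A B (φ.lTensor B ((b ⊗ₜ 1) * Δ)) =
        b * TensorProduct.rid A B (φ.lTensor B Δ) := by
      rw [hs]; simp [Finset.mul_sum]
    simp only [e2, ← hu] at this
    rw [mul_comm, ← this, hs]
    simp [Finset.mul_sum]
  let lam : B →ₗ[A] A := φ ∘ₗ LinearMap.mulLeft A (↑u⁻¹ : B)
  -- The two families of components of `Δ` are dual to each other under `lam`.
  have h2 (x : B) : ∑ i ∈ s, lam (x * i.2) • i.1 = x := by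
    simpa [lam, mul_assoc] using h1 (↑u⁻¹ * x)
  refine ⟨lam, fun ψ => ⟨∑ i ∈ s, ψ i.1 • i.2, fun x => ?_⟩, fun c hc => ?_, fun y => ?_⟩
  · conv_lhs => rw [← h2 x]
    simp [Finset.mul_sum, mul_comm]
  · rw [← h2 c]; simp [hc]
  -- Multiplication by `y` becomes a sum of rank-one maps, whose traces are read off.
  · have h3 : Algebra.lmul A B y =
        ∑ i ∈ s, (lam ∘ₗ LinearMap.mulLeft A i.2).smulRight (y * i.1) := by
      ext x
      simp only [Algebra.coe_lmul_eq_mul, LinearMap.mul_apply', LinearMap.coe_sum,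
        Finset.sum_apply, LinearMap.smulRight_apply, LinearMap.comp_apply,
        LinearMap.mulLeft_apply]
      conv_lhs => rw [← h2 x]
      simp [Finset.mul_sum, mul_comm]
    rw [Algebra.trace_apply, h3, map_sum]
    simp only [LinearMap.trace_smulRight]
    rw [hs]
    simp only [map_sum, Finset.sum_mul, LinearMap.comp_apply, LinearMap.mulLeft_apply,
      Algebra.TensorProduct.lmul'_apply_tmul]
    refine Finset.sum_congr rfl fun i _ => congrArg lam ?_
    ring

/-! ### Residue field of a presentation -/

namespace LocalCompleteIntersection

variable {R S : Type*} [CommRing R] [IsLocalRing R] [CommRing S] [Algebra R S] {m : ℕ}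
  (P : LocalCompleteIntersection R S m)

/-- The map `R[T₁, …, Tₘ] → S` of a presentation, as a homomorphism of `R`-algebras. -/
noncomputable def imageHom : MvPolynomial (Fin m) R →ₐ[R] S :=
  (P.equiv.toAlgHom.comp (Ideal.Quotient.mkₐ R _)).comp
    (IsScalarTower.toAlgHom R (MvPolynomial (Fin m) R) (Localization.AtPrime P.ideal))

theorem imageHom_apply (g : MvPolynomial (Fin m) R) : P.imageHom g = P.image g := rfl

theorem imageHom_relation (i : Fin m) : P.imageHom (P.relation i) = 0 := by
  rw [imageHom_apply, image, Ideal.Quotient.eq_zero_iff_mem.2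
    (Ideal.subset_span (Set.mem_range_self i)),
    map_zero]

theorem isUnit_imageHom_iff {g : MvPolynomial (Fin m) R} :
    IsUnit (P.imageHom g) ↔ g ∉ P.ideal := by
  constructor
  · intro hg hgP
    rw [imageHom_apply, image, MulEquiv.isUnit_map] at hg
    have hle : Ideal.span (Set.range fun i => algebraMap (MvPolynomial (Fin m) R)
        (Localization.AtPrime P.ideal) (P.relation i)) ≤
        maximalIdeal (Localization.AtPrime P.ideal) := by
      rw [Ideal.span_le]
      rintro _ ⟨i, rfl⟩
      exact (IsLocalization.AtPrime.to_map_mem_maximal_iff _ P.ideal _).2 (P.relation_mem i)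
    have hg' := (IsLocalization.AtPrime.to_map_mem_maximal_iff (Localization.AtPrime P.ideal)
      P.ideal g).2 hgP
    have hu := hg.map (Ideal.Quotient.factor hle)
    rw [Ideal.Quotient.factor_mk, Ideal.Quotient.eq_zero_iff_mem.2 hg'] at hu
    have : Nontrivial (Localization.AtPrime P.ideal ⧸
      maximalIdeal (Localization.AtPrime P.ideal)) :=
      Ideal.Quotient.nontrivial_iff.2 (Ideal.IsPrime.ne_top inferInstance)
    exact not_isUnit_zero hu
  · intro hg
    exact (((IsLocalization.map_units (Localization.AtPrime P.ideal)
      (⟨g, hg⟩ : P.ideal.primeCompl)).map (Ideal.Quotient.mk _)).map P.equiv)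

theorem exists_imageHom_mul_eq (b : S) :
    ∃ p q, q ∉ P.ideal ∧ P.imageHom q * b = P.imageHom p := by
  obtain ⟨y, hy⟩ := Ideal.Quotient.mk_surjective (P.equiv.symm b)
  obtain ⟨⟨p, q⟩, hpq⟩ := IsLocalization.surj P.ideal.primeCompl y
  refine ⟨p, q, q.2, ?_⟩
  have hb : b = P.equiv (Ideal.Quotient.mk _ y) := by rw [hy, AlgEquiv.apply_symm_apply]
  rw [hb, imageHom_apply, imageHom_apply, image, image, ← map_mul, ← map_mul, mul_comm, hpq]

theorem mem_ideal_iff [IsLocalRing S] {g : MvPolynomial (Fin m) R} :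
    g ∈ P.ideal ↔ P.imageHom g ∈ maximalIdeal S := by
  rw [mem_maximalIdeal, mem_nonunits_iff, isUnit_imageHom_iff, not_not]

/-- Polynomials modulo `𝔫` already form a field, so denominators outside `𝔫` can be inverted there.
-/
theorem residue_imageHom_surjective [IsLocalRing S] :
    Function.Surjective fun g => residue S (P.imageHom g) := by
  intro x
  obtain ⟨b, rfl⟩ := residue_surjective x
  obtain ⟨p, q, hq, hpq⟩ := P.exists_imageHom_mul_eq b
  obtain ⟨r, y, hy, hr⟩ := P.isMaximal.exists_inv hq
  refine ⟨r * p, ?_⟩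
  have hr' : residue S (P.imageHom r) * residue S (P.imageHom q) = 1 := by
    rw [P.mem_ideal_iff, ← residue_eq_zero_iff] at hy
    have := congrArg (fun z => residue S (P.imageHom z)) hr
    simpa [hy] using this
  simp only [map_mul, ← hpq]
  rw [← mul_assoc, hr', one_mul]

theorem isLocalHom_algebraMap (P : LocalCompleteIntersection R S m) [IsLocalRing S] :
    IsLocalHom (algebraMap R S) := by
  constructor
  intro a ha
  by_contra hna
  have h1 : a ∈ P.ideal.under R := by
    rw [← (P.liesOver).over]; exact hna
  rw [Ideal.mem_comap, ← not_not (a := _ ∈ _), ← isUnit_imageHom_iff] at h1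
  apply h1
  rw [AlgHom.commutes]
  exact ha

/-- Zariski's lemma: a field of finite type over a field is finite over it. -/
theorem finite_residueField (P : LocalCompleteIntersection R S m) [IsLocalRing S] :
    Module.Finite R (ResidueField S) := by
  have := P.isLocalHom_algebraMap
  let π : S →ₐ[R] ResidueField S := IsScalarTower.toAlgHom R S (ResidueField S)
  have h1 : Algebra.FiniteType R (ResidueField S) :=
    Algebra.FiniteType.of_surjective (π.comp P.imageHom) P.residue_imageHom_surjective
  have h2 : Algebra.FiniteType (ResidueField R) (ResidueField S) :=
    Algebra.FiniteType.of_restrictScalars_finiteType R _ _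
  have h3 : Module.Finite (ResidueField R) (ResidueField S) :=
    finite_of_finite_type_of_isJacobsonRing _ _
  have h4 : Module.Finite R (ResidueField R) :=
    Module.Finite.of_surjective (Algebra.linearMap R (ResidueField R)) residue_surjective
  exact Module.Finite.trans (ResidueField R) _

end LocalCompleteIntersection

/-! ### Finiteness over a complete discrete valuation ring -/

theorem IsPrecomplete.pi_of_finite {R ι : Type*} [CommRing R] (I : Ideal R) [IsPrecomplete I R]
    [Finite ι] : IsPrecomplete I (ι → R) := by
  cases nonempty_fintype ι
  classical
  rw [← AdicCompletion.of_surjective_iff]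
  intro x
  obtain ⟨z, rfl⟩ := AdicCompletion.ofTensorProduct_surjective_of_finite I (ι → R) x
  induction z with
  | zero => exact ⟨0, by simp⟩
  | tmul a v =>
    obtain ⟨a, rfl⟩ := AdicCompletion.of_surjective I R a
    refine ⟨a • v, ?_⟩
    rw [AdicCompletion.ofTensorProduct_tmul, map_smul]
    ext n : 1
    simp only [AdicCompletion.of_apply, AdicCompletion.smul_eval]
    rfl
  | add x y hx hy =>
    obtain ⟨x', hx⟩ := hx
    obtain ⟨y', hy⟩ := hy
    exact ⟨x' + y', by rw [map_add, map_add, hx, hy]⟩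

/-- A discrete valuation ring which dominates a complete discrete valuation ring and has a finite
residue field extension is finite. -/
theorem Module.Finite.of_finite_residueField {A B : Type*}
    [CommRing A] [IsDomain A] [IsDiscreteValuationRing A] [IsAdicComplete (maximalIdeal A) A]
    [CommRing B] [IsDomain B] [IsDiscreteValuationRing B] [Algebra A B]
    (hinj : Function.Injective (algebraMap A B)) [IsLocalHom (algebraMap A B)]
    [Module.Finite A (ResidueField B)] : Module.Finite A B := by
  obtain ⟨ϖ, hϖ⟩ := IsDiscreteValuationRing.exists_irreducible B
  obtain ⟨a, ha⟩ := IsDiscreteValuationRing.exists_irreducible A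
  obtain ⟨e, he⟩ := IsDiscreteValuationRing.associated_pow_irreducible
    (x := algebraMap A B a) (by rw [map_ne_zero_iff _ hinj]; exact ha.ne_zero) hϖ
  let π : B →ₗ[A] ResidueField B := (IsScalarTower.toAlgHom A B (ResidueField B)).toLinearMap
  have hπ : Function.Surjective π := residue_surjective
  obtain ⟨N₁, hN₁, hN₁π⟩ : ∃ N : Submodule A B, N.FG ∧ N.map π = ⊤ := by
    obtain ⟨s, hs⟩ := Module.Finite.fg_top (R := A) (M := ResidueField B)
    classical
    refine ⟨Submodule.span A (s.image (Function.surjInv hπ)), ⟨_, rfl⟩, ?_⟩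
    rw [Submodule.map_span, ← hs]
    congr 1
    ext x
    simp [Function.surjInv_eq]
  have hN₁' (b : B) : ∃ n ∈ N₁, ∃ c, b = n + ϖ * c := by
    obtain ⟨n, hn, hnb⟩ : π b ∈ N₁.map π := hN₁π ▸ trivial
    have : b - n ∈ maximalIdeal B := by
      rw [← residue_eq_zero_iff, map_sub, sub_eq_zero]; exact hnb.symm
    rw [hϖ.maximalIdeal_eq, Ideal.mem_span_singleton] at this
    obtain ⟨c, hc⟩ := this
    exact ⟨n, hn, c, by rw [← hc]; ring⟩
  -- Successive approximation gives `B = N + ϖ ^ j B` with `N` finitely generated; for `j = e`, the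
  -- ramification index, this reads `B = N + 𝔪_A B`.
  have hN (j : ℕ) : ∃ N : Submodule A B, N.FG ∧ ∀ b, ∃ n ∈ N, ∃ c, b = n + ϖ ^ j * c := by
    induction j with
    | zero => exact ⟨⊥, Submodule.fg_bot, fun b => ⟨0, zero_mem _, b, by simp⟩⟩
    | succ j ih =>
      obtain ⟨N, hN, hb⟩ := ih
      refine ⟨N₁ ⊔ N.map (LinearMap.mulLeft A ϖ), hN₁.sup (hN.map _), fun b => ?_⟩
      obtain ⟨n, hn, c, rfl⟩ := hN₁' b
      obtain ⟨n', hn', c', rfl⟩ := hb c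
      exact ⟨n + ϖ * n', Submodule.add_mem_sup hn ⟨n', hn', rfl⟩, c', by ring⟩
  obtain ⟨N, hN, hb⟩ := hN e
  obtain ⟨r, f, hf⟩ := (Submodule.fg_iff_exists_fin_linearMap A B).1 hN
  have hle : (maximalIdeal A).map (algebraMap A B) ≤ maximalIdeal B :=
    ((local_hom_TFAE (algebraMap A B)).out 0 2).1 ‹IsLocalHom (algebraMap A B)›
  have := IsHausdorff.of_map (M := B) hle
  have := IsPrecomplete.pi_of_finite (ι := Fin r) (maximalIdeal A)
  -- Surjectivity modulo `𝔪_A` lifts, as the source is complete and the target separated.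
  have hsurj : Function.Surjective f := by
    refine surjective_of_mkQ_comp_surjective (I := maximalIdeal A) fun x => ?_
    obtain ⟨b, rfl⟩ := Submodule.mkQ_surjective _ x
    obtain ⟨n, hn, c, hbc⟩ := hb b
    rw [← hf] at hn
    obtain ⟨v, rfl⟩ := hn
    refine ⟨v, ?_⟩
    rw [LinearMap.comp_apply, ← sub_eq_zero, ← map_sub, Submodule.mkQ_apply,
      Submodule.Quotient.mk_eq_zero, hbc, sub_add_cancel_left]
    obtain ⟨u, hu⟩ := he
    have : ϖ ^ e * c = a • (↑u * c) := by
      rw [Algebra.smul_def, ← hu]; ring_nf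
    rw [this]
    exact neg_mem (Submodule.smul_mem_smul ((mem_maximalIdeal a).2 ha.1) trivial)
  exact Module.Finite.of_surjective f hsurj

/-! ### Expansions around a point and the local ring at the origin -/

namespace MvPolynomial

theorem exists_eq_mulVec_X {ι σ R : Type*} [Fintype σ] [CommRing R] (F : ι → MvPolynomial σ R)
    (hF : ∀ i, constantCoeff (F i) = 0) : ∃ c : Matrix ι σ (MvPolynomial σ R), F = c.mulVec X := by
  have h (i) : ∃ c : σ → MvPolynomial σ R, ∑ j, c j * X j = F i := by
    rw [← Ideal.mem_span_range_iff_exists_fun, ← Set.image_univ, mem_ideal_span_X_image]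
    intro d hd
    by_contra! hd'
    have : d = 0 := by ext j; exact hd' j trivial
    rw [this, mem_support_iff] at hd
    exact hd (hF i)
  choose c hc using h
  exact ⟨Matrix.of c, by ext1 i; exact (hc i).symm⟩

theorem constantCoeff_pderiv_mulVec_X {ι σ R : Type*} [Fintype σ] [CommRing R]
    (c : Matrix ι σ (MvPolynomial σ R)) (i : ι) (j : σ) :
    constantCoeff (pderiv j (c.mulVec X i)) = constantCoeff (c i j) := by
  classical
  simp [Matrix.mulVec, dotProduct, Derivation.leibniz, pderiv_X, Pi.single_apply,
    apply_ite constantCoeff]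

theorem pderiv_aeval_X_add_C {σ A B : Type*} [CommRing A] [CommRing B] [Algebra A B] (t : σ → B)
    (j : σ) (p : MvPolynomial σ A) :
    pderiv j (aeval (fun j => X j + C (t j)) p : MvPolynomial σ B) =
      aeval (fun j => X j + C (t j)) (pderiv j p) := by
  classical
  induction p using MvPolynomial.induction_on with
  | C a => simp [algebraMap_apply]
  | add p q hp hq => simp [hp, hq]
  | mul_X p i hp =>
    simp [hp, Derivation.leibniz, pderiv_X, Pi.single_apply, apply_ite]

theorem constantCoeff_aeval_X_add_C {σ A B : Type*} [CommRing A] [CommRing B] [Algebra A B]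
    (t : σ → B) (p : MvPolynomial σ A) :
    constantCoeff (aeval (fun j => X j + C (t j)) p : MvPolynomial σ B) = aeval t p := by
  induction p using MvPolynomial.induction_on with
  | C a => simp [algebraMap_apply]
  | add p q hp hq => simp [hp, hq]
  | mul_X p i hp => simp [hp]

/-- The quotient of the local ring of affine space at the origin by the ideal `⟨F⟩`. -/
theorem exists_quotient_localization_origin.{u, v} {ι A : Type*} {σ : Type u} {K : Type v} [CommRing A] [Field K] [Algebra A K]
    (F : ι → MvPolynomial σ K) :
    ∃ (O : Type (max u v)) (_ : CommRing O) (_ : Algebra A O) (κ : MvPolynomial σ K →ₐ[A] O),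
      (∀ h, constantCoeff h ≠ 0 → IsUnit (κ h)) ∧
      ∀ x, κ x = 0 ↔ ∃ h, constantCoeff h ≠ 0 ∧ h * x ∈ Ideal.span (Set.range F) := by
  let p : Ideal (MvPolynomial σ K) := RingHom.ker constantCoeff
  have hp : p.IsPrime := RingHom.ker_isPrime _
  let I : Ideal (Localization.AtPrime p) :=
    (Ideal.span (Set.range F)).map (algebraMap (MvPolynomial σ K) (Localization.AtPrime p))
  refine ⟨Localization.AtPrime p ⧸ I, inferInstance, inferInstance,
    (Ideal.Quotient.mkₐ A I).comp (IsScalarTower.toAlgHom A _ _), fun h hh => ?_, fun x => ?_⟩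
  · exact (IsLocalization.map_units (Localization.AtPrime p)
      (⟨h, hh⟩ : p.primeCompl)).map (Ideal.Quotient.mkₐ A I)
  · simp only [AlgHom.comp_apply, Ideal.Quotient.mkₐ_eq_mk, IsScalarTower.coe_toAlgHom',
      Ideal.Quotient.eq_zero_iff_mem, I]
    rw [IsLocalization.algebraMap_mem_map_algebraMap_iff p.primeCompl]
    rfl

end MvPolynomial

/-! ### The tensor lifting the Jacobian -/

namespace LocalCompleteIntersection

open MvPolynomial

variable {R S : Type*} [CommRing R] [IsLocalRing R] [CommRing S] [Algebra R S] {m : ℕ}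
  (P : LocalCompleteIntersection R S m)

/-- The universal property of a presentation. -/
theorem exists_algHom_imageHom {O : Type*} [CommRing O] [Algebra R O]
    (χ : MvPolynomial (Fin m) R →ₐ[R] O) (hu : ∀ g ∉ P.ideal, IsUnit (χ g))
    (hχ : ∀ i, χ (P.relation i) = 0) : ∃ φ : S →ₐ[R] O, ∀ g, φ (P.imageHom g) = χ g := by
  let χ' : Localization.AtPrime P.ideal →ₐ[R] O :=
    IsLocalization.liftAlgHom (M := P.ideal.primeCompl) (f := χ) fun y => hu y y.2
  have hχ' (g) : χ' (algebraMap _ _ g) = χ g := by simp [χ']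
  have hker : ∀ a ∈ Ideal.span (Set.range fun i => algebraMap (MvPolynomial (Fin m) R)
      (Localization.AtPrime P.ideal) (P.relation i)), χ' a = 0 := by
    intro a ha
    have : Ideal.span (Set.range fun i => algebraMap (MvPolynomial (Fin m) R)
      (Localization.AtPrime P.ideal) (P.relation i)) ≤ RingHom.ker χ' := by
      rw [Ideal.span_le]
      rintro _ ⟨i, rfl⟩
      exact (hχ' _).trans (hχ i)
    exact this ha
  refine ⟨(Ideal.Quotient.liftₐ _ χ' hker).comp P.equiv.symm.toAlgHom, fun g => ?_⟩
  rw [← hχ', imageHom_apply, image]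
  simp only [AlgHom.comp_apply, AlgEquiv.coe_toAlgHom, AlgEquiv.symm_apply_apply]
  exact Ideal.Quotient.liftₐ_apply _ _ _ _

theorem imageHom_eq_aeval (g : MvPolynomial (Fin m) R) :
    P.imageHom g = aeval (fun j => P.imageHom (X j)) g := by
  conv_lhs => rw [aeval_unique P.imageHom]
  rfl

/-- Translation by the residues of the `tⱼ` moves the closed point to the origin: `𝔫` consists of
the polynomials whose translate vanishes there. So the universal property maps `S` to the local ring
of the translated relations. -/
theorem exists_residue_algHom.{v} {S : Type v} [CommRing S] [Algebra R S]
    (P : LocalCompleteIntersection R S m) [IsLocalRing S] : ∃ (O : Type v) (_ : CommRing O) (_ : Algebra R O)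
      (κ : MvPolynomial (Fin m) (ResidueField S) →ₐ[R] O) (φ : S →ₐ[R] O),
      (∀ h, constantCoeff h ≠ 0 → IsUnit (κ h)) ∧
      (∀ x, κ x = 0 ↔ ∃ h, constantCoeff h ≠ 0 ∧ h * x ∈ Ideal.span (Set.range fun i =>
        map (residue S) (aeval (fun j => X j + C (P.imageHom (X j))) (P.relation i)))) ∧
      ∀ j, φ (P.imageHom (X j)) = κ (X j + C (residue S (P.imageHom (X j)))) := by
  let sh : MvPolynomial (Fin m) R →ₐ[R] MvPolynomial (Fin m) (ResidueField S) :=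
    aeval (fun j => X j + C (residue S (P.imageHom (X j))))
  have hsh (g : MvPolynomial (Fin m) R) : sh g =
      map (residue S) (aeval (fun j => X j + C (P.imageHom (X j))) g) := by
    induction g using MvPolynomial.induction_on with
    | C a => simp [sh, MvPolynomial.algebraMap_apply, IsScalarTower.algebraMap_apply R S (ResidueField S)]
    | add p q hp hq => simp only [map_add, hp, hq]
    | mul_X p i hp => rw [map_mul, hp]; simp [sh]
  obtain ⟨O, _, _, κ, hκu, hκ⟩ := exists_quotient_localization_origin (A := R) (fun i =>
    map (residue S) (aeval (fun j => X j + C (P.imageHom (X j))) (P.relation i)))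
  obtain ⟨φ, hφ⟩ := P.exists_algHom_imageHom (κ.comp sh) (fun g hg => hκu _ (by
      change constantCoeff (sh g) ≠ 0
      rw [hsh, constantCoeff_map, constantCoeff_aeval_X_add_C, ← imageHom_eq_aeval]
      rw [P.mem_ideal_iff, ← residue_eq_zero_iff] at hg
      exact hg)) (fun i => by
      rw [AlgHom.comp_apply, hsh]
      exact (hκ _).2 ⟨1, by simp, by rw [one_mul]; exact Ideal.subset_span ⟨i, rfl⟩⟩)
  exact ⟨O, _, _, κ, φ, hκu, hκ, fun j => by rw [hφ]; simp [sh]⟩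

/-- There is a symmetric element of `S ⊗ S` which maps to the Jacobian in `S`, and whose image in
`κ ⊗ S`, where `κ` is the residue field of `S`, does not vanish. -/
theorem exists_tensor_jacobian [IsLocalRing S] [Algebra.IsIntegral R S] : ∃ Δ : S ⊗[R] S,
    (∀ b : S, (1 ⊗ₜ b) * Δ = (b ⊗ₜ 1) * Δ) ∧ Algebra.TensorProduct.lmul' R Δ = P.jacobian ∧
    (IsScalarTower.toAlgHom R S (ResidueField S)).toLinearMap.rTensor S Δ ≠ 0 := by
  set t : Fin m → S := fun j => P.imageHom (X j) with ht
  have haeval (g) : P.imageHom g = aeval t g := P.imageHom_eq_aeval g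
  let F : Fin m → MvPolynomial (Fin m) S := fun i => aeval (fun j => X j + C (t j)) (P.relation i)
  obtain ⟨c, hc⟩ := exists_eq_mulVec_X F fun i => by
    rw [constantCoeff_aeval_X_add_C, ← haeval, imageHom_relation]
  -- This substitution turns `g(X + t)` into `1 ⊗ g(t)`, which vanishes for the relations.
  let θ : MvPolynomial (Fin m) S →ₐ[S] S ⊗[R] S := aeval fun j => 1 ⊗ₜ t j - t j ⊗ₜ 1
  have hθF (g : MvPolynomial (Fin m) R) :
      θ (aeval (fun j => X j + C (t j)) g) = 1 ⊗ₜ (P.imageHom g) := by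
    induction g using MvPolynomial.induction_on with
    | C a =>
      rw [algHom_C, ← algebraMap_eq, AlgHom.commutes,
        IsScalarTower.algebraMap_apply R S (MvPolynomial (Fin m) S), AlgHom.commutes,
        ← IsScalarTower.algebraMap_apply]
      exact Algebra.TensorProduct.algebraMap_apply' a
    | add p q hp hq => simp only [map_add, hp, hq, tmul_add]
    | mul_X p i hp =>
      rw [map_mul, map_mul, hp, map_mul, aeval_X, map_add, aeval_X, ← algebraMap_eq,
        AlgHom.commutes, Algebra.TensorProduct.algebraMap_apply, Algebra.algebraMap_self_apply,
        sub_add_cancel, Algebra.TensorProduct.tmul_mul_tmul, one_mul]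
  let c' := c.map θ
  have hdet : θ c.det = c'.det := AlgHom.map_det θ c
  have hgen (j) : c'.det * (1 ⊗ₜ t j - t j ⊗ₜ 1) = 0 := by
    have h1 : c'.mulVec (fun j => 1 ⊗ₜ t j - t j ⊗ₜ 1) = 0 := by
      ext1 i
      have h2 := congrArg θ (congrFun hc i)
      rw [hθF, imageHom_relation, tmul_zero] at h2
      rw [Pi.zero_apply, h2]
      simp [Matrix.mulVec, dotProduct, c', θ]
    have h3 := congrArg (c'.adjugate.mulVec ·) h1
    simp only [Matrix.mulVec_mulVec, Matrix.adjugate_mul, Matrix.smul_mulVec, Matrix.one_mulVec,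
      Matrix.mulVec_zero] at h3
    exact congrFun h3 j
  refine ⟨θ c.det, fun b => ?_, ?_, ?_⟩
  · have hpoly (g : MvPolynomial (Fin m) R) :
        (1 ⊗ₜ P.imageHom g) * c'.det = (P.imageHom g ⊗ₜ 1) * c'.det := by
      induction g using MvPolynomial.induction_on with
      | C a =>
        rw [← algebraMap_eq, AlgHom.commutes, Algebra.algebraMap_eq_smul_one, tmul_smul, smul_tmul']
      | add p q hp hq => simp only [map_add, tmul_add, add_tmul, add_mul, hp, hq]
      | mul_X p i hp =>
        have h1 : (1 ⊗ₜ P.imageHom (X i)) * c'.det = (P.imageHom (X i) ⊗ₜ 1) * c'.det := by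
          have := hgen i
          rw [mul_sub, sub_eq_zero] at this
          rw [mul_comm, this, mul_comm]
        have e1 : (1 : S) ⊗ₜ[R] (P.imageHom p * P.imageHom (X i)) =
          (1 ⊗ₜ P.imageHom p) * (1 ⊗ₜ P.imageHom (X i)) := by simp
        have e2 : (P.imageHom p * P.imageHom (X i)) ⊗ₜ[R] (1 : S) =
          (P.imageHom p ⊗ₜ 1) * (P.imageHom (X i) ⊗ₜ 1) := by simp
        rw [map_mul, e1, e2, mul_assoc, h1, mul_left_comm, hp, mul_left_comm, mul_assoc]
    obtain ⟨p, q, hq, hpq⟩ := P.exists_imageHom_mul_eq b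
    rw [← isUnit_imageHom_iff] at hq
    have hq' : IsUnit ((1 : S) ⊗ₜ[R] P.imageHom q) :=
      hq.map (Algebra.TensorProduct.includeRight (R := R) (A := S) (B := S))
    rw [hdet]
    apply hq'.mul_left_cancel
    have e1 : (1 ⊗ₜ P.imageHom q) * ((1 : S) ⊗ₜ[R] b * c'.det) = (1 ⊗ₜ P.imageHom p) * c'.det := by
      rw [← mul_assoc, Algebra.TensorProduct.tmul_mul_tmul, hpq, one_mul]
    rw [e1, hpoly, mul_left_comm, hpoly, ← mul_assoc, Algebra.TensorProduct.tmul_mul_tmul,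
      mul_comm b, hpq, one_mul]
  -- After multiplication `θ` is evaluation at `X = 0`, and the linear coefficients of `fᵢ(X + t)`
  -- are the partial derivatives at `t`.
  · have hμ (x : MvPolynomial (Fin m) S) :
        Algebra.TensorProduct.lmul' R (θ x) = constantCoeff x := by
      induction x using MvPolynomial.induction_on with
      | C a => simp [θ]
      | add p q hp hq => simp only [map_add, hp, hq]
      | mul_X p i hp => simp [θ]
    rw [hμ, RingHom.map_det, jacobian]
    congr 1
    ext i j
    simp only [RingHom.mapMatrix_apply, Matrix.map_apply, Matrix.of_apply]
    rw [← constantCoeff_pderiv_mulVec_X, ← hc, pderiv_aeval_X_add_C, constantCoeff_aeval_X_add_C,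
      ← haeval, imageHom_apply]
  · obtain ⟨O, _, _, κ, φ, hκu, hκ, hφ⟩ := P.exists_residue_algHom
    let ι : ResidueField S →ₐ[R] O := κ.comp (Algebra.ofId _ _ |>.restrictScalars R)
    let ρ : ResidueField S ⊗[R] S →ₐ[R] O := Algebra.TensorProduct.lift ι φ fun _ _ => .all _ _
    let ρ' : S ⊗[R] S →ₐ[R] O := ρ.comp
      (Algebra.TensorProduct.map (IsScalarTower.toAlgHom R S (ResidueField S)) (.id R S))
    have hρ' (x : MvPolynomial (Fin m) S) : ρ' (θ x) = κ (map (residue S) x) := by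
      induction x using MvPolynomial.induction_on with
      | C a => simp [θ, ρ', ρ, ι, Algebra.ofId_apply, algebraMap_eq]
      | add p q hp hq => simp only [map_add, hp, hq]
      | mul_X p i hp =>
        rw [map_mul, map_mul, hp, map_mul, map_mul, map_X]
        congr 1
        simp [θ, ρ', ρ, ι, Algebra.ofId_apply, algebraMap_eq, t, hφ]
    -- A monic equation of `tⱼ` reduces to `(Y - τ) ^ r * u` with `u(τ) ≠ 0`. At `Y = Xⱼ + τ` the
    -- factor `u` is a unit in `O`, so `Xⱼ ^ r = 0` there.
    have hnil (j : Fin m) : ∃ N, κ (X j ^ N) = 0 := by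
      obtain ⟨p, hp, hpt⟩ := Algebra.IsIntegral.isIntegral (R := R) (t j)
      let τ := residue S (t j)
      let q := p.map (algebraMap R (ResidueField S))
      have hq : q ≠ 0 := (hp.map _).ne_zero
      obtain ⟨u, hu, hu'⟩ := Polynomial.exists_eq_pow_rootMultiplicity_mul_and_not_dvd q hq τ
      refine ⟨q.rootMultiplicity τ, ?_⟩
      let e := Polynomial.aeval (R := ResidueField S)
        (X j + C τ : MvPolynomial (Fin m) (ResidueField S))
      have h1 : κ (e q) = 0 := by
        have h2 : e q = Polynomial.aeval (X j + C τ) p := by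
          simp only [e, q, Polynomial.aeval_map_algebraMap]
        rw [h2, ← Polynomial.aeval_algHom_apply, ← hφ, Polynomial.aeval_algHom_apply]
        rw [← Polynomial.aeval_def] at hpt
        rw [hpt, map_zero]
      have h2 : e q = X j ^ q.rootMultiplicity τ * e u := by
        conv_lhs => rw [hu]
        simp [e, algebraMap_eq]
      have h3 : IsUnit (κ (e u)) := by
        apply hκu
        have : constantCoeff (e u) = u.eval τ := by
          have := Polynomial.hom_eval₂ u (algebraMap _ (MvPolynomial (Fin m) (ResidueField S)))
            constantCoeff (X j + C τ)
          simp only [e, Polynomial.aeval_def, this]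
          simp [algebraMap_eq, Polynomial.eval₂_eq_eval_map]
        rw [this]
        intro h
        exact hu' (Polynomial.dvd_iff_isRoot.2 h)
      rw [h2, map_mul] at h1
      exact (h3.mul_left_eq_zero).1 h1
    intro hzero
    have hρΔ : ρ' (θ c.det) = 0 := by
      have : ρ' (θ c.det) = ρ ((IsScalarTower.toAlgHom R S (ResidueField S)).toLinearMap.rTensor S
        (θ c.det)) := rfl
      rw [this, hzero, map_zero]
    rw [hρ', hκ] at hρΔ
    obtain ⟨h₀, hh₀, hd⟩ := hρΔ
    choose N hN using hnil
    have hN' (j) := (hκ _).1 (hN j)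
    choose h hh hX using hN'
    let C' := c.map (map (residue S))
    have hC' : (fun i => map (residue S) (aeval (fun j => X j + C (P.imageHom (X j)))
        (P.relation i))) = C'.mulVec X := by
      ext1 i
      have := congrArg (map (residue S)) (congrFun hc i)
      refine this.trans ?_
      simp [Matrix.mulVec, dotProduct, C']
    rw [hC'] at hd hX
    refine mul_det_notMem_span C' (h := h₀ * ∏ j, h j) ?_ N (fun i => ?_) ?_
    · simp only [map_mul, map_prod]
      exact mul_ne_zero hh₀ (Finset.prod_ne_zero_iff.2 fun i _ => hh i)
    · rw [← Finset.mul_prod_erase _ _ (Finset.mem_univ i)]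
      -- One common denominator serves all indices; the extra `X i` raises the exponent `N i` to `N
      -- i + 1`.
      convert Ideal.mul_mem_left _ (h₀ * (∏ j ∈ Finset.univ.erase i, h j) * X i) (hX i) using 1
      ring
    · rw [RingHom.map_det] at hd
      convert Ideal.mul_mem_left _ (∏ j, h j) hd using 1
      rw [mul_comm h₀, mul_assoc]
      rfl

end LocalCompleteIntersection

/-! ### A generator of the dual module -/

/-- An element of `S ⊗ S` whose image in `κ ⊗ S` does not vanish is sent to a unit by
`id ⊗ φ` for some functional `φ`. -/
theorem exists_isUnit_lTensor_of_rTensor_residue_ne_zero {R S : Type*} [CommRing R] [CommRing S]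
    [IsLocalRing S] [Algebra R S] [Module.Free R S] [Module.Finite R S] (Δ : S ⊗[R] S)
    (hΔ : (IsScalarTower.toAlgHom R S (ResidueField S)).toLinearMap.rTensor S Δ ≠ 0) :
    ∃ φ : S →ₗ[R] R, IsUnit (TensorProduct.rid R S (φ.lTensor S Δ)) := by
  by_contra! hcon
  apply hΔ
  let b := Module.Free.chooseBasis R S
  -- If no coefficient of `Δ` in this basis of the second factor is a unit, all of them die in `κ`.
  have hexp : Δ = ∑ k, TensorProduct.rid R S ((b.coord k).lTensor S Δ) ⊗ₜ b k := by
    clear hcon hΔ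
    induction Δ with
    | zero => simp
    | add x y hx hy =>
      conv_lhs => rw [hx, hy]
      simp only [map_add, add_tmul, Finset.sum_add_distrib]
    | tmul x y =>
      conv_lhs => rw [← b.sum_repr y]
      simp [tmul_sum, smul_tmul, -Module.Basis.sum_repr]
  rw [hexp, map_sum]
  refine Finset.sum_eq_zero fun k _ => ?_
  rw [LinearMap.rTensor_tmul]
  have : residue S (TensorProduct.rid R S ((b.coord k).lTensor S Δ)) = 0 :=
    (residue_eq_zero_iff _).2 (hcon (b.coord k))
  have h2 : (IsScalarTower.toAlgHom R S (ResidueField S)).toLinearMap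
    (TensorProduct.rid R S ((b.coord k).lTensor S Δ)) = 0 := this
  rw [h2, zero_tmul]

namespace LocalCompleteIntersection

/-- Tate's description of the trace of a finite free complete intersection. -/
theorem exists_generator_dual {R S : Type*} [CommRing R] [IsLocalRing R] [CommRing S]
    [IsLocalRing S] [Algebra R S] [Module.Free R S] [Module.Finite R S] {m : ℕ}
    (P : LocalCompleteIntersection R S m) :
    ∃ lam : S →ₗ[R] R, (∀ ψ : S →ₗ[R] R, ∃ c, ∀ x, ψ x = lam (c * x)) ∧
      (∀ c, (∀ x, lam (c * x) = 0) → c = 0) ∧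
      ∀ y, Algebra.trace R S y = lam (P.jacobian * y) := by
  obtain ⟨Δ, hΔ, hJ, hne⟩ := P.exists_tensor_jacobian
  obtain ⟨φ, hφ⟩ := exists_isUnit_lTensor_of_rTensor_residue_ne_zero Δ hne
  rw [← hJ]
  exact exists_generator_dual_of_tmul_comm Δ hΔ φ hφ

end LocalCompleteIntersection

/-! ### Codifferent and different -/

/-- The codifferent of a finite free algebra, if the trace is `J` times a generator of the dual. -/
theorem codifferent_eq_span_inv {A M B F : Type*} [CommRing A] [IsDomain A] [IsIntegrallyClosed A]
    [Field M] [Algebra A M] [IsFractionRing A M] [CommRing B] [IsDomain B] [IsIntegrallyClosed B]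
    [Field F] [Algebra B F] [IsFractionRing B F]
    [Algebra A B] [Algebra M F] [Algebra A F] [IsScalarTower A M F] [IsScalarTower A B F]
    [FiniteDimensional M F] [Algebra.IsSeparable M F] [Module.Free A B] [Module.Finite A B]
    {lam : B →ₗ[A] A} (hgen : ∀ ψ : B →ₗ[A] A, ∃ c, ∀ x, ψ x = lam (c * x))
    (hnd : ∀ c, (∀ x, lam (c * x) = 0) → c = 0) {J : B}
    (htr : ∀ y, Algebra.trace A B y = lam (J * y)) :
    J ≠ 0 ∧ codifferent A M B F = Submodule.span B {(algebraMap B F J)⁻¹} := by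
  have hIC : IsIntegralClosure B A F := .of_isIntegrallyClosed B A F
  have hloc : IsLocalization (Algebra.algebraMapSubmonoid B (nonZeroDivisors A)) F :=
    IsIntegralClosure.isLocalization A M F B
  have htrF (b : B) : Algebra.trace M F (algebraMap B F b) = algebraMap A M (lam (J * b)) := by
    rw [Algebra.trace_localization A (nonZeroDivisors A), htr]
  have hAM : Function.Injective (algebraMap A M) := IsFractionRing.injective A M
  have hBF : Function.Injective (algebraMap B F) := IsFractionRing.injective B F
  have hfrac (x : F) : ∃ (b : B) (a : A), a ≠ 0 ∧
      algebraMap A M a • x = algebraMap B F b := by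
    obtain ⟨⟨b, _, a, ha, rfl⟩, hb⟩ :=
      IsLocalization.surj (Algebra.algebraMapSubmonoid B (nonZeroDivisors A)) x
    refine ⟨b, a, nonZeroDivisors.ne_zero ha, ?_⟩
    rw [← hb, Algebra.smul_def, mul_comm, ← IsScalarTower.algebraMap_apply,
      ← IsScalarTower.algebraMap_apply]
  -- `J = 0` would make the trace form of a separable extension vanish.
  have hJ : J ≠ 0 := by
    rintro rfl
    apply Algebra.trace_ne_zero M F
    ext x
    obtain ⟨b, a, ha, hb⟩ := hfrac x
    have h1 : algebraMap A M a * Algebra.trace M F x = 0 := by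
      rw [← smul_eq_mul, ← map_smul, hb, htrF]; simp
    exact (mul_eq_zero.1 h1).resolve_left ((map_ne_zero_iff _ hAM).2 ha)
  have hJF : algebraMap B F J ≠ 0 := (map_ne_zero_iff _ hBF).2 hJ
  have htrJ (c : B) : Algebra.trace M F ((algebraMap B F J)⁻¹ * algebraMap B F c) =
      algebraMap A M (lam c) := by
    obtain ⟨b, a, ha, hb⟩ := hfrac ((algebraMap B F J)⁻¹ * algebraMap B F c)
    have h2 : J * b = a • c := by
      apply hBF
      rw [map_mul, ← hb, Algebra.smul_def, Algebra.smul_def, map_mul,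
        ← IsScalarTower.algebraMap_apply, ← IsScalarTower.algebraMap_apply]
      field_simp
    apply mul_left_cancel₀ ((map_ne_zero_iff _ hAM).2 ha)
    rw [← smul_eq_mul, ← map_smul, hb, htrF, h2, map_smul, smul_eq_mul, map_mul]
  refine ⟨hJ, le_antisymm (fun x hx => ?_) ?_⟩
  · rw [mem_codifferent] at hx
    -- The functional `Tr(x ·)` on `B` is `lam(c ·)`, and nondegeneracy of `lam` forces `x = J⁻¹c`.
    choose ψ hψ using hx
    let ψ' : B →ₗ[A] A :=
      { toFun := ψ
        map_add' := fun b b' => hAM <| by simp only [map_add, hψ, mul_add]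
        map_smul' := fun a b => hAM <| by
          rw [hψ, RingHom.id_apply, smul_eq_mul, (algebraMap A M).map_mul, hψ,
            ← smul_eq_mul (a := algebraMap A M a), ← map_smul, Algebra.smul_def, Algebra.smul_def,
            (algebraMap B F).map_mul, ← IsScalarTower.algebraMap_apply, ← IsScalarTower.algebraMap_apply, mul_left_comm] }
    obtain ⟨c, hc⟩ := hgen ψ'
    obtain ⟨b, a, ha, hb⟩ := hfrac (x - (algebraMap B F J)⁻¹ * algebraMap B F c)
    have hb0 : J * b = 0 := by
      refine hnd _ fun y => hAM ?_
      rw [mul_assoc, ← htrF, map_mul, ← hb, smul_mul_assoc, map_smul, sub_mul, map_sub, ← hψ,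
        mul_assoc, ← map_mul, htrJ, ← hc]
      exact (congrArg _ (sub_self _)).trans (by simp)
    have hb1 : b = 0 := (mul_eq_zero.1 hb0).resolve_left hJ
    rw [hb1, map_zero, smul_eq_zero, sub_eq_zero] at hb
    rw [hb.resolve_left ((map_ne_zero_iff _ hAM).2 ha), mul_comm, ← Algebra.smul_def]
    exact Submodule.smul_mem _ _ (Submodule.mem_span_singleton_self _)
  · rw [Submodule.span_singleton_le_iff_mem, mem_codifferent]
    exact fun b => ⟨lam b, (htrJ b).symm⟩

theorem Submodule.one_div_span_singleton_inv {B F : Type*} [CommRing B] [Field F] [Algebra B F]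
    {x : F} (hx : x ≠ 0) :
    (1 : Submodule B F) / Submodule.span B {x⁻¹} = Submodule.span B {x} := by
  ext y
  rw [Submodule.mem_div_iff_forall_mul_mem, Submodule.mem_span_singleton]
  constructor
  · intro h
    obtain ⟨b, hb⟩ := Submodule.mem_one.1 (h _ (Submodule.mem_span_singleton_self _))
    exact ⟨b, by rw [Algebra.smul_def, hb, inv_mul_cancel_right₀ hx]⟩
  · rintro ⟨b, rfl⟩ z hz
    obtain ⟨c, rfl⟩ := Submodule.mem_span_singleton.1 hz
    refine Submodule.mem_one.2 ⟨b * c, ?_⟩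
    rw [Algebra.smul_def, Algebra.smul_def, map_mul]
    field_simp


/-- `A` and `B` are the rings of integers of the complete discrete valuation fields `M` and `F`. -/
theorem mainTheorem9 {A M B F : Type*}
    [CommRing A] [IsDomain A] [IsDiscreteValuationRing A]
    [IsAdicComplete (IsLocalRing.maximalIdeal A) A]
    [Field M] [Algebra A M] [IsFractionRing A M]
    [CommRing B] [IsDomain B] [IsDiscreteValuationRing B]
    [IsAdicComplete (IsLocalRing.maximalIdeal B) B]
    [Field F] [Algebra B F] [IsFractionRing B F]
    [Algebra A B] [Algebra M F] [Algebra A F] [IsScalarTower A M F] [IsScalarTower A B F]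
    [FiniteDimensional M F] [Algebra.IsSeparable M F]
    {m : ℕ} (P : LocalCompleteIntersection A B m) :
    P.jacobian ≠ 0 ∧
      codifferent A M B F = Submodule.span B {(algebraMap B F P.jacobian)⁻¹} ∧
      different A M B F = Submodule.span B {algebraMap B F P.jacobian} := by
  have hinj : Function.Injective (algebraMap A B) := by
    have : Function.Injective (algebraMap A F) := by
      rw [IsScalarTower.algebraMap_eq A M F]
      exact (algebraMap M F).injective.comp (IsFractionRing.injective A M)
    rw [IsScalarTower.algebraMap_eq A B F] at this
    exact Function.Injective.of_comp this
  have := P.isLocalHom_algebraMap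
  have := P.finite_residueField
  have := Module.Finite.of_finite_residueField hinj
  have : Module.IsTorsionFree A B := Module.isTorsionFree_iff_algebraMap_injective.2 hinj
  -- Finite and torsion-free over a principal ideal domain.
  have : Module.Free A B := inferInstance
  obtain ⟨lam, hgen, hnd, htr⟩ := P.exists_generator_dual
  obtain ⟨hJ, hcod⟩ := codifferent_eq_span_inv (M := M) (F := F) hgen hnd htr
  refine ⟨hJ, hcod, ?_⟩
  rw [different, hcod]
  exact Submodule.one_div_span_singleton_inv
    ((map_ne_zero_iff _ (IsFractionRing.injective B F)).2 hJ)
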